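/- **Definitions.** An *almost quaternionic manifold* $(M,I,J,K)$ is a smooth manifold $M$ of dimension $4n$ with smooth almost complex structures $I,J,K$ such that $IJ=K$. Let $(\tau,s,t)$ be the standard coordinates on $\mathbb{R}^3$. A linear map $A\colon\mathbb{R}^3\to T_xM$ is *quaternion-antilinear* if $IA\partial_\tau+JA\partial_s+KA\partial_t=0$. For a smooth function $\rho\colon M\to\mathbb{R}$ put $\sigma^I_\rho=-d(d\rho\circ I)$, and similarly for $J$ and $K$. The function $\rho$ is *$IJK$-convex* at $x$ if for every non-zero quaternion-antilinear $A\colon\mathbb{R}^3\to T_xM$ the three-form $$A^*\sigma^I_\rho\wedge d\tau+A^*\sigma^J_\rho\wedge ds+A^*\sigma^K_\rho\wedge dt$$ is a negative multiple of $d\tau\wedge ds\wedge dt$. A non-compact almost quaternionic manifold has an *$IJK$-conical end* defined by $\rho$ if $\rho\colon M\to\mathbb{R}$ is smooth and exhausting (proper and bounded below) and, outside a compact subset of $M$, is $IJK$-convex and has no critical points. In that case a submanifold $L\subset M$ is *$JK$-conical* if, at all points of $L$ outside a compact subset, $d\rho$ is non-zero on $TL$ and vanishes on $J(TL)$ and $K(TL)$.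 A *Fueter strip with boundary on $L_0$ and $L_1$* is a $C^2$ map $U\colon[0,1]\times\mathbb{R}^2\to M$ such that $$I(U)\partial_\tau U+J(U)\partial_sU+K(U)\partial_tU=0,\qquad U(0,s,t)\in L_0,\quad U(1,s,t)\in L_1,$$ such that $\partial_sU(\tau,\cdot,\cdot)\in L^1(\mathbb{R}^2)\cap L^2(\mathbb{R}^2)$ for every $\tau\in[0,1]$, and such that there are points $p_\pm\in L_0\cap L_1$ and $C^1$ maps $u_\pm\colon\mathbb{R}\times[0,1]\to M$, $(t,\tau)\mapsto u_\pm(t,\tau)$, with $$\lim_{s\to\pm\infty}U(\tau,s,t)=u_\pm(t,\tau)\ \text{ in } C^1(\mathbb{R}\times[0,1]),\qquad \lim_{t\to\pm\infty}U(\tau,s,t)=p_\pm\ \text{ in } C^1_{\mathrm{loc}}([0,1]\times\mathbb{R}),$$ where each $u\in\{u_+,u_-\}$ satisfies $\partial_tu-J(u)\partial_\tau u=0$, $u(t,0)\in L_0$ and $u(t,1)\in L_1$ for all $t$, and $u(t,\tau)\to p_\pm$ as $t\to\pm\infty$ for all $\tau\in[0,1]$. **Theorem (maximum principle).** Let $(M,I,J,K)$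 be an almost quaternionic manifold with an $IJK$-conical end defined by $\rho$, and let $L_0,L_1\subset M$ be submanifolds, each of which is compact or $JK$-conical (with respect to $\rho$), with compact intersection $L_0\cap L_1$. Then there is a compact subset $M_0\subset M$ that contains the image of every Fueter strip $U\colon[0,1]\times\mathbb{R}^2\to M$ with boundary on $L_0$ and $L_1$. -/

import Mathlib

open Set Filter Topology Manifold MeasureTheory Bundle
open scoped ContDiff

noncomputable section

namespace Fueter

/-- `ℝ³` with its standard coordinates `(τ, s, t)`. -/
abbrev R3 : Type := ℝ × ℝ × ℝ

/-- The coordinate vector `∂_τ`. -/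
def eTau : R3 := (1, 0, 0)

/-- The coordinate vector `∂_s`. -/
def eS : R3 := (0, 1, 0)

/-- The coordinate vector `∂_t`. -/
def eT : R3 := (0, 0, 1)

/-- The closed slab `[0,1] × ℝ²` in `ℝ³`. -/
def slab : Set R3 := Icc (0 : ℝ) 1 ×ˢ univ

section Defs

variable {E : Type*} [NormedAddCommGroup E] [NormedSpace ℝ E]
variable {M : Type*} [TopologicalSpace M] [ChartedSpace E M]

/-- The endomorphisms of the tangent space of `M` at `x`. -/
abbrev TEnd (E : Type*) [NormedAddCommGroup E] [NormedSpace ℝ E]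
    {M : Type*} [TopologicalSpace M] [ChartedSpace E M] (x : M) : Type _ :=
  TangentSpace 𝓘(ℝ, E) x →L[ℝ] TangentSpace 𝓘(ℝ, E) x

/-- A field of endomorphisms of the tangent bundle is smooth, as a section of `End(TM)`. -/
def SmoothEnd [IsManifold 𝓘(ℝ, E) ∞ M] (A : ∀ x : M, TEnd E x) : Prop :=
  ContMDiff 𝓘(ℝ, E) (𝓘(ℝ, E).prod 𝓘(ℝ, E →L[ℝ] E)) ∞
    (fun x => TotalSpace.mk' (E →L[ℝ] E)
      (E := fun x : M => TangentSpace 𝓘(ℝ, E) x →L[ℝ] TangentSpace 𝓘(ℝ, E) x) x (A x))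

/-- An almost quaternionic structure on `M`: a triple of (smooth) almost complex structures
`I`, `J`, `K` with `IJ = K`. -/
structure QuatStructure (E : Type*) [NormedAddCommGroup E] [NormedSpace ℝ E]
    (M : Type*) [TopologicalSpace M] [ChartedSpace E M] [IsManifold 𝓘(ℝ, E) ∞ M] where
  I : ∀ x : M, TEnd E x
  J : ∀ x : M, TEnd E x
  K : ∀ x : M, TEnd E x
  smooth_I : SmoothEnd I
  smooth_J : SmoothEnd J
  smooth_K : SmoothEnd K
  I_sq : ∀ x v, I x (I x v) = -v
  J_sq : ∀ x v, J x (J x v) = -v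
  K_sq : ∀ x v, K x (K x v) = -v
  I_J : ∀ x v, I x (J x v) = K x v

/-! ### Quaternion-antilinear maps and convexity -/

/-- A linear map `A : ℝ³ → T_x M` is quaternion-antilinear if
`I A ∂_τ + J A ∂_s + K A ∂_t = 0`. -/
def IsQuatAntilinear [IsManifold 𝓘(ℝ, E) ∞ M] (Q : QuatStructure E M) (x : M)
    (A : R3 →L[ℝ] TangentSpace 𝓘(ℝ, E) x) : Prop :=
  Q.I x (A eTau) + Q.J x (A eS) + Q.K x (A eT) = 0

/-- The expression of a one-form `θ` on `M` in the preferred chart `φ` around `x`, that is, the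
pull-back `(φ⁻¹)^* θ`, as a one-form on the model space (meaningful on the target of `φ`). -/
def oneFormInChart (θ : ∀ y : M, TangentSpace 𝓘(ℝ, E) y →L[ℝ] ℝ) (x : M) :
    E → E [⋀^Fin 1]→L[ℝ] ℝ :=
  fun z => ContinuousAlternatingMap.ofSubsingleton ℝ E ℝ (0 : Fin 1)
    ((θ ((extChartAt 𝓘(ℝ, E) x).symm z)).comp
      (mfderiv 𝓘(ℝ, E) 𝓘(ℝ, E) (extChartAt 𝓘(ℝ, E) x).symm z))

/-- The exterior derivative `dθ` of a one-form `θ` on `M`, evaluated on `v, w ∈ T_x M`;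
it is computed in the preferred chart around `x`. -/
def dOneForm (θ : ∀ y : M, TangentSpace 𝓘(ℝ, E) y →L[ℝ] ℝ) (x : M)
    (v w : TangentSpace 𝓘(ℝ, E) x) : ℝ :=
  extDeriv (oneFormInChart θ x) (extChartAt 𝓘(ℝ, E) x x)
    ![mfderiv 𝓘(ℝ, E) 𝓘(ℝ, E) (extChartAt 𝓘(ℝ, E) x) x v,
      mfderiv 𝓘(ℝ, E) 𝓘(ℝ, E) (extChartAt 𝓘(ℝ, E) x) x w]

/-- The differential `dρ` of a function `ρ : M → ℝ`. -/
def dFun (ρ : M → ℝ) (x : M) : TangentSpace 𝓘(ℝ, E) x →L[ℝ] ℝ :=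
  mfderiv 𝓘(ℝ, E) 𝓘(ℝ, ℝ) ρ x

/-- The Levi form `σ_ρ^A = -d(dρ ∘ A)` of `ρ` with respect to an almost complex structure `A`. -/
def leviForm (A : ∀ x : M, TEnd E x) (ρ : M → ℝ) (x : M)
    (v w : TangentSpace 𝓘(ℝ, E) x) : ℝ :=
  -dOneForm (fun y => (dFun ρ y).comp (A y)) x v w

/-- The coefficient, with respect to `dτ ∧ ds ∧ dt`, of the pull-back by the graph of
`A : ℝ³ → T_x M` of the `IJK`-Levi form
`σ_ρ = σ_ρ^I ∧ dτ + σ_ρ^J ∧ ds + σ_ρ^K ∧ dt`. -/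
def leviPullback [IsManifold 𝓘(ℝ, E) ∞ M] (Q : QuatStructure E M) (ρ : M → ℝ) (x : M)
    (A : R3 →L[ℝ] TangentSpace 𝓘(ℝ, E) x) : ℝ :=
  leviForm Q.I ρ x (A eS) (A eT) + leviForm Q.J ρ x (A eT) (A eTau)
    + leviForm Q.K ρ x (A eTau) (A eS)

/-- `ρ` is `IJK`-convex at the point `x`: the pull-back of the `IJK`-Levi form by every non-zero
quaternion-antilinear map `ℝ³ → T_x M` is a negative multiple of the volume form. -/
def IsQuatConvexAt [IsManifold 𝓘(ℝ, E) ∞ M] (Q : QuatStructure E M) (ρ : M → ℝ) (x : M) : Prop :=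
  ∀ A : R3 →L[ℝ] TangentSpace 𝓘(ℝ, E) x,
    IsQuatAntilinear Q x A → A ≠ 0 → leviPullback Q ρ x A < 0

/-- The non-compact almost quaternionic manifold `(M, I, J, K)` has an `IJK`-conical end defined
by the exhausting (smooth, bounded below and proper, i.e. with compact sublevel sets) function
`ρ`: outside a compact subset, `ρ` is `IJK`-convex and has no critical points. -/
structure IsConicalEnd [IsManifold 𝓘(ℝ, E) ∞ M] (Q : QuatStructure E M) (ρ : M → ℝ) : Prop where
  noncompact : NoncompactSpace M
  smooth : ContMDiff 𝓘(ℝ, E) 𝓘(ℝ, ℝ) ∞ ρ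
  exhausting : ∀ c : ℝ, IsCompact {x | ρ x ≤ c}
  conical : ∃ C : Set M, IsCompact C ∧
    ∀ x ∉ C, IsQuatConvexAt Q ρ x ∧ dFun (E := E) ρ x ≠ 0

/-! ### Submanifolds -/

/-- `L` is a smooth embedded submanifold of `M` (without boundary): near each of its points
there is a chart of the smooth structure of `M` that takes `L` to a linear subspace. -/
def IsSubmanifold (E : Type*) [NormedAddCommGroup E] [NormedSpace ℝ E]
    {M : Type*} [TopologicalSpace M] [ChartedSpace E M] (L : Set M) : Prop :=
  ∀ x ∈ L, ∃ φ ∈ IsManifold.maximalAtlas 𝓘(ℝ, E) ∞ M, x ∈ φ.source ∧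
    ∃ W : Submodule ℝ E, φ '' (φ.source ∩ L) = φ.target ∩ W

/-- `v ∈ T_x M` is tangent to `L` at `x`: it is the velocity at time `0` of a `C¹` curve in `L`
through `x`. -/
def IsTangentTo (L : Set M) (x : M) (v : TangentSpace 𝓘(ℝ, E) x) : Prop :=
  ∃ γ : ℝ → M, ContMDiff 𝓘(ℝ, ℝ) 𝓘(ℝ, E) 1 γ ∧ (∀ r, γ r ∈ L) ∧
    (⟨γ 0, mfderiv 𝓘(ℝ, ℝ) 𝓘(ℝ, E) γ 0 (1 : ℝ)⟩ : TangentBundle 𝓘(ℝ, E) M) = ⟨x, v⟩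

/-- `L` is `JK`-conical with respect to `ρ`: outside a compact subset, `dρ` is non-zero on `TL`
and vanishes on `J(TL)` and `K(TL)`. -/
def IsJKConical [IsManifold 𝓘(ℝ, E) ∞ M] (Q : QuatStructure E M) (ρ : M → ℝ)
    (L : Set M) : Prop :=
  ∃ C : Set M, IsCompact C ∧ ∀ x ∈ L, x ∉ C →
    (∃ v : TangentSpace 𝓘(ℝ, E) x, IsTangentTo L x v ∧ dFun ρ x v ≠ 0) ∧
    ∀ v : TangentSpace 𝓘(ℝ, E) x, IsTangentTo L x v →
      dFun ρ x (Q.J x v) = 0 ∧ dFun ρ x (Q.K x v) = 0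

/-! ### Convergence of maps -/

/-- Uniform convergence on `S` of the maps `F i` to `f`, for maps to a topological space `Y` that
carries no preferred metric: for each open neighbourhood `N` of the diagonal of `Y × Y`, the pairs
`(f z, F i z)`, `z ∈ S`, eventually all lie in `N`. If `f` takes `S` to a relatively compact
subset of a metrizable `Y`, this is uniform convergence for any compatible metric. -/
def ConvUniformlyOn {ι X Y : Type*} [TopologicalSpace Y] (S : Set X)
    (F : ι → X → Y) (l : Filter ι) (f : X → Y) : Prop :=
  ∀ N : Set (Y × Y), IsOpen N → (∀ y, (y, y) ∈ N) → ∀ᶠ i in l, ∀ z ∈ S, (f z, F i z) ∈ N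

/-- The derivative within `S` at the point `z`, in the direction `v`, of a map from (a subset of)
the plane to `M`, together with its base point, as a point of `TM`. -/
def tangentPt (E : Type*) [NormedAddCommGroup E] [NormedSpace ℝ E]
    {M : Type*} [TopologicalSpace M] [ChartedSpace E M]
    (f : ℝ × ℝ → M) (S : Set (ℝ × ℝ)) (v : ℝ × ℝ) (z : ℝ × ℝ) : TangentBundle 𝓘(ℝ, E) M :=
  ⟨f z, mfderivWithin 𝓘(ℝ, ℝ × ℝ) 𝓘(ℝ, E) f S z v⟩

/-- `C¹`-convergence, uniform on `C ⊆ S`, of maps `F i : S → M` to `f : S → M`: the maps and their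
directional derivatives converge uniformly on `C`. -/
def ConvC1On [IsManifold 𝓘(ℝ, E) ∞ M] (S C : Set (ℝ × ℝ)) {ι : Type*}
    (F : ι → ℝ × ℝ → M) (l : Filter ι) (f : ℝ × ℝ → M) : Prop :=
  ∀ v : ℝ × ℝ, ConvUniformlyOn C (fun i => tangentPt E (F i) S v) l (tangentPt E f S v)

/-! ### Fueter strips -/

/-- `U` is a Fueter map on `S ⊆ ℝ³`: its derivative is everywhere quaternion-antilinear, i.e.
`I(U) ∂_τ U + J(U) ∂_s U + K(U) ∂_t U = 0`. -/
def IsFueterOn [IsManifold 𝓘(ℝ, E) ∞ M] (Q : QuatStructure E M) (U : R3 → M) (S : Set R3) : Prop :=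
  ∀ p ∈ S, IsQuatAntilinear Q (U p) (mfderivWithin 𝓘(ℝ, R3) 𝓘(ℝ, E) U S p)

/-- The strip `ℝ × [0,1]`, with coordinates `(t, τ)`. -/
def stripTTau : Set (ℝ × ℝ) := univ ×ˢ Icc (0 : ℝ) 1

/-- The strip `[0,1] × ℝ`, with coordinates `(τ, s)`. -/
def stripTauS : Set (ℝ × ℝ) := Icc (0 : ℝ) 1 ×ˢ univ

/-- `u : ℝ × [0,1] → M`, with coordinates `(t, τ)`, is a `J`-antiholomorphic strip,
`∂_t u - J(u) ∂_τ u = 0`, with boundary on `L₀` and `L₁`, and it converges to `p` as `t → -∞`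
and to `q` as `t → +∞`. -/
structure IsAntiholStrip [IsManifold 𝓘(ℝ, E) ∞ M] (Q : QuatStructure E M) (L₀ L₁ : Set M)
    (p q : M) (u : ℝ × ℝ → M) : Prop where
  contMDiffOn : ContMDiffOn 𝓘(ℝ, ℝ × ℝ) 𝓘(ℝ, E) 1 u stripTTau
  antihol : ∀ z ∈ stripTTau,
    mfderivWithin 𝓘(ℝ, ℝ × ℝ) 𝓘(ℝ, E) u stripTTau z ((1, 0) : ℝ × ℝ)
      - Q.J (u z) (mfderivWithin 𝓘(ℝ, ℝ × ℝ) 𝓘(ℝ, E) u stripTTau z ((0, 1) : ℝ × ℝ)) = 0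
  boundary_zero : ∀ t : ℝ, u (t, 0) ∈ L₀
  boundary_one : ∀ t : ℝ, u (t, 1) ∈ L₁
  tendsto_bot : ∀ τ ∈ Icc (0 : ℝ) 1, Tendsto (fun t : ℝ => u (t, τ)) atBot (𝓝 p)
  tendsto_top : ∀ τ ∈ Icc (0 : ℝ) 1, Tendsto (fun t : ℝ => u (t, τ)) atTop (𝓝 q)

/-- The length `|∂_s U|` at the point `a`, with respect to the Riemannian metric `g`. -/
def normDS [IsManifold 𝓘(ℝ, E) ∞ M]
    (g : ContMDiffRiemannianMetric 𝓘(ℝ, E) ∞ E (fun x : M => TangentSpace 𝓘(ℝ, E) x))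
    (U : R3 → M) (a : R3) : ℝ :=
  Real.sqrt (g.inner (U a) (mfderivWithin 𝓘(ℝ, R3) 𝓘(ℝ, E) U slab a eS)
    (mfderivWithin 𝓘(ℝ, R3) 𝓘(ℝ, E) U slab a eS))

/-- `U : [0,1] × ℝ² → M` is a Fueter strip with boundary on `L₀` and `L₁`: a `C²` solution of the
Fueter equation with `U(0, ·) ∈ L₀`, `U(1, ·) ∈ L₁`, with `∂_s U(τ, ·, ·) ∈ L¹ ∩ L²`, and with
* `U(τ, s, t) → u_±(t, τ)` in `C¹(ℝ × [0,1])` as `s → ±∞`,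
* `U(τ, s, t) → p_±` in `C¹_loc([0,1] × ℝ)` as `t → ±∞`,
where `p_± ∈ L₀ ∩ L₁` and `u_±` are `J`-antiholomorphic strips with boundary on `L₀` and `L₁`
that converge to `p_±` as `t → ±∞`. (The image of such a `U` is relatively compact, so that the
integrability condition does not depend on the Riemannian metric.) -/
structure IsFueterStrip [IsManifold 𝓘(ℝ, E) ∞ M] (Q : QuatStructure E M) (L₀ L₁ : Set M)
    (U : R3 → M) : Prop where
  contMDiffOn : ContMDiffOn 𝓘(ℝ, R3) 𝓘(ℝ, E) 2 U slab
  fueter : IsFueterOn Q U slab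
  boundary_zero : ∀ s t : ℝ, U (0, s, t) ∈ L₀
  boundary_one : ∀ s t : ℝ, U (1, s, t) ∈ L₁
  integrable :
    ∃ g : ContMDiffRiemannianMetric 𝓘(ℝ, E) ∞ E (fun x : M => TangentSpace 𝓘(ℝ, E) x),
      ∀ τ ∈ Icc (0 : ℝ) 1,
        Integrable (fun z : ℝ × ℝ => normDS g U (τ, z.1, z.2)) ∧
        Integrable (fun z : ℝ × ℝ => normDS g U (τ, z.1, z.2) ^ 2)
  asymptotics :
    ∃ pm ∈ L₀ ∩ L₁, ∃ pp ∈ L₀ ∩ L₁, ∃ um up : ℝ × ℝ → M,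
      IsAntiholStrip Q L₀ L₁ pm pp um ∧ IsAntiholStrip Q L₀ L₁ pm pp up ∧
      ConvC1On (E := E) stripTTau stripTTau
        (fun (s : ℝ) (z : ℝ × ℝ) => U (z.2, s, z.1)) atBot um ∧
      ConvC1On (E := E) stripTTau stripTTau
        (fun (s : ℝ) (z : ℝ × ℝ) => U (z.2, s, z.1)) atTop up ∧
      ∀ C ⊆ stripTauS, IsCompact C →
        ConvC1On (E := E) stripTauS C
          (fun (t : ℝ) (z : ℝ × ℝ) => U (z.1, z.2, t)) atBot (fun _ => pm) ∧
        ConvC1On (E := E) stripTauS C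
          (fun (t : ℝ) (z : ℝ × ℝ) => U (z.1, z.2, t)) atTop (fun _ => pp)

end Defs

end Fueter

end

namespace Fueter

/-! ### A maximum principle on the slab -/

/-! Put `f = ρ ∘ U`. Multiplying the Fueter equation by `I`, `J`, `K` writes each partial derivative
of `f` as a difference of coefficients of the pull-backs of `dρ ∘ I`, `dρ ∘ J`, `dρ ∘ K`.
Differentiating once more gives `Δf = -leviPullback` (`leviPullback_mfderiv_eq_neg_laplacian`), so
`f` is subharmonic wherever `ρ` is convex. On the faces `τ = 0, 1` the vectors `∂_s U` and `∂_t U`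
are tangent to `L₀` or `L₁`, and conicality turns the first of these identities into `∂_τ f = 0`
(`neumann_of_conicalAbove`).

Let `R` bound `ρ` on the intersection and on the compact sets where convexity or conicality may
fail. For each `c > R` the asymptotics give `f ≤ c` for large `|t|`, uniformly in `s`. For large
`|s|` they give only boundedness, since the limits `u_±` carry no a priori bound by `R`. A barrier
growing in `s` closes this gap (`le_of_subharmonic_neumann`). Hence `f ≤ R` for every strip. -/

/-- The iterated directional derivative `∂_e ∂_e f` at `p`. -/
noncomputable def dirDeriv2 {V : Type*} [NormedAddCommGroup V] [NormedSpace ℝ V]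
    (f : V → ℝ) (e p : V) : ℝ :=
  fderiv ℝ (fun q => fderiv ℝ f q e) p e

/-- The Laplacian of a function on `ℝ³`. -/
noncomputable def laplacian3 (f : R3 → ℝ) (p : R3) : ℝ :=
  dirDeriv2 f eTau p + dirDeriv2 f eS p + dirDeriv2 f eT p

/-- A positive second derivative would make `x` a local minimum as well, hence `h` locally constant,
with vanishing second derivative. -/
lemma deriv_deriv_nonpos_of_isLocalMax {h : ℝ → ℝ} {x : ℝ} (hmax : IsLocalMax h x)
    (hc : ContinuousAt h x) : deriv (deriv h) x ≤ 0 := by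
  by_contra! hpos
  have hmin := isLocalMin_of_deriv_deriv_pos hpos hmax.deriv_eq_zero hc
  have heq : h =ᶠ[𝓝 x] fun _ => h x := by
    filter_upwards [hmin, hmax] with y h1 h2 using le_antisymm h2 h1
  have : deriv (deriv h) x = 0 := by
    rw [heq.deriv.deriv_eq]
    simp
  linarith

section

variable {V : Type*} [NormedAddCommGroup V] [NormedSpace ℝ V]

lemma differentiableAt_fderiv_apply {f : V → ℝ} {p : V} (hf : ContDiffAt ℝ 2 f p) (e : V) :
    DifferentiableAt ℝ (fun q => fderiv ℝ f q e) p :=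
  ((hf.fderiv_right (m := 1) (by norm_num)).differentiableAt (by norm_num)).clm_apply
    (differentiableAt_const e)

lemma ContDiffAt.eventually_differentiableAt {W : Type*} [NormedAddCommGroup W] [NormedSpace ℝ W]
    {f : V → W} {p : V} (hf : ContDiffAt ℝ 2 f p) : ∀ᶠ q in 𝓝 p, DifferentiableAt ℝ f q := by
  filter_upwards [hf.eventually (by simp)] with q hq using hq.differentiableAt (by norm_num)

lemma dirDeriv2_nonpos_of_isLocalMax {f : V → ℝ} {p : V} (hf : ContDiffAt ℝ 2 f p)
    (hmax : IsLocalMax f p) (e : V) : dirDeriv2 f e p ≤ 0 := by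
  have hline : ∀ x : ℝ, HasDerivAt (fun x : ℝ => p + x • e) e x := fun x => by
    simpa using ((hasDerivAt_id x).smul_const e).const_add p
  have hp : p + (0 : ℝ) • e = p := by simp
  have hcont : Tendsto (fun x : ℝ => p + x • e) (𝓝 0) (𝓝 p) := by
    have := (hline 0).continuousAt
    rwa [ContinuousAt, hp] at this
  have h1 : deriv (fun x : ℝ => f (p + x • e)) =ᶠ[𝓝 0] fun x => fderiv ℝ f (p + x • e) e := by
    filter_upwards [hcont.eventually (ContDiffAt.eventually_differentiableAt hf)] with x hx
    exact (hx.hasFDerivAt.comp_hasDerivAt x (hline x)).deriv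
  have h2 : deriv (deriv fun x : ℝ => f (p + x • e)) 0 = dirDeriv2 f e p := by
    rw [h1.deriv_eq]
    have hd := differentiableAt_fderiv_apply hf e
    rw [← hp] at hd
    have := (hd.hasFDerivAt.comp_hasDerivAt (0 : ℝ) (hline 0)).deriv
    rw [hp] at this
    exact this
  rw [← h2]
  refine deriv_deriv_nonpos_of_isLocalMax ?_ ?_
  · have := hcont.eventually hmax
    simpa [IsLocalMax, IsMaxFilter] using this
  · exact ContinuousAt.comp (f := fun x : ℝ => p + x • e) (g := f)
      (by rw [hp]; exact hf.continuousAt) (hline 0).continuousAt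

lemma dirDeriv2_sub {f g : V → ℝ} {p : V} (hf : ContDiffAt ℝ 2 f p) (hg : ContDiffAt ℝ 2 g p)
    (e : V) : dirDeriv2 (fun q => f q - g q) e p = dirDeriv2 f e p - dirDeriv2 g e p := by
  have h : (fun q => fderiv ℝ (fun q => f q - g q) q e)
      =ᶠ[𝓝 p] fun q => fderiv ℝ f q e - fderiv ℝ g q e := by
    filter_upwards [ContDiffAt.eventually_differentiableAt hf,
      ContDiffAt.eventually_differentiableAt hg] with q h1 h2
    rw [fderiv_fun_sub h1 h2]
    rfl
  rw [dirDeriv2, h.fderiv_eq,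
    fderiv_fun_sub (differentiableAt_fderiv_apply hf e) (differentiableAt_fderiv_apply hg e)]
  rfl

end

/-- The barrier function of the maximum principle on the slab. -/
noncomputable def barrier (ε : ℝ) (q : R3) : ℝ :=
  ε * (q.2.1 ^ 2 + (q.1 - 1 / 2) ^ 2 - 3 * q.2.2 ^ 2)

lemma contDiff_barrier (ε : ℝ) : ContDiff ℝ 2 (barrier ε) := by
  unfold barrier
  fun_prop

/-- The coefficients give `2 + 2 - 6 < 0`, so subtracting the barrier makes a subharmonic function
strictly subharmonic. The term in `s` forces decay as `|s| → ∞`, the term in `τ` has outward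
derivative `ε` on both faces, and the negative term in `t` is harmless because `|t|` will be
bounded. -/
lemma laplacian3_barrier (ε : ℝ) (p : R3) : laplacian3 (barrier ε) p = -2 * ε := by
  have h1 : ∀ q : R3, HasFDerivAt (fun q : R3 => q.1) (ContinuousLinearMap.fst ℝ ℝ (ℝ × ℝ)) q :=
    fun q => hasFDerivAt_fst
  have h2 : ∀ q : R3, HasFDerivAt (fun q : R3 => q.2.1)
      ((ContinuousLinearMap.fst ℝ ℝ ℝ).comp (ContinuousLinearMap.snd ℝ ℝ (ℝ × ℝ))) q :=
    fun q => hasFDerivAt_snd.fst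
  have h3 : ∀ q : R3, HasFDerivAt (fun q : R3 => q.2.2)
      ((ContinuousLinearMap.snd ℝ ℝ ℝ).comp (ContinuousLinearMap.snd ℝ ℝ (ℝ × ℝ))) q :=
    fun q => hasFDerivAt_snd.snd
  have hb := fun q : R3 => (((((h2 q).pow 2).add (((h1 q).sub_const (1 / 2)).pow 2)).sub
    (((h3 q).pow 2).const_mul 3)).const_mul ε).fderiv
  have e1 : (fun q => fderiv ℝ (barrier ε) q eTau) = fun q => ε * (2 * (q.1 - 1 / 2)) := by
    funext q; erw [hb q]; simp [eTau]
  have e2 : (fun q => fderiv ℝ (barrier ε) q eS) = fun q => ε * (2 * q.2.1) := by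
    funext q; erw [hb q]; simp [eS]
  have e3 : (fun q => fderiv ℝ (barrier ε) q eT) = fun q => ε * (-6 * q.2.2) := by
    funext q; erw [hb q]; simp [eT, -mul_eq_mul_left_iff]; ring
  have f1 := ((((h1 p).sub_const (1 / 2)).const_mul 2).const_mul ε).fderiv
  have f2 := (((h2 p).const_mul 2).const_mul ε).fderiv
  have f3 := (((h3 p).const_mul (-6)).const_mul ε).fderiv
  simp only [laplacian3, dirDeriv2, e1, e2, e3, f1, f2, f3]
  simp [eTau, eS, eT]
  ring

lemma le_zero_of_hasDerivWithinAt_of_max_left {h : ℝ → ℝ} {h' : ℝ}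
    (hd : HasDerivWithinAt h h' (Icc 0 1) 0) (hmax : ∀ x ∈ Icc (0 : ℝ) 1, h x ≤ h 0) : h' ≤ 0 := by
  have hd' := hasDerivWithinAt_iff_tendsto_slope.1 hd
  have : Icc (0 : ℝ) 1 \ {0} = Ioc 0 1 := by ext; simp [lt_iff_le_and_ne]
  rw [this] at hd'
  have : (𝓝[Ioc (0 : ℝ) 1] 0).NeBot := by
    rw [nhdsWithin_Ioc_eq_nhdsGT one_pos]; infer_instance
  refine le_of_tendsto hd' ?_
  filter_upwards [self_mem_nhdsWithin] with x hx
  rw [slope_def_field]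
  exact div_nonpos_of_nonpos_of_nonneg (by linarith [hmax x ⟨hx.1.le, hx.2⟩]) (by linarith [hx.1])

lemma zero_le_of_hasDerivWithinAt_of_max_right {h : ℝ → ℝ} {h' : ℝ}
    (hd : HasDerivWithinAt h h' (Icc 0 1) 1) (hmax : ∀ x ∈ Icc (0 : ℝ) 1, h x ≤ h 1) : 0 ≤ h' := by
  have hr : HasDerivWithinAt (fun x : ℝ => 1 - x) (-1) (Icc 0 1) 0 := by
    simpa using ((hasDerivWithinAt_id (0 : ℝ) (Icc 0 1)).const_sub 1)
  have hd1 : HasDerivWithinAt h h' (Icc 0 1) (1 - 0) := by simpa using hd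
  have := hd1.comp (0 : ℝ) hr (fun x hx => ⟨by linarith [hx.2], by linarith [hx.1]⟩)
  have := le_zero_of_hasDerivWithinAt_of_max_left this
    (fun x hx => by simpa using hmax (1 - x) ⟨by linarith [hx.2], by linarith [hx.1]⟩)
  linarith

/-- A maximum principle on the slab `[0,1] × ℝ²`, with Neumann boundary conditions, for functions
that are bounded above and are only required to be subharmonic where they exceed `c`. -/
theorem le_of_subharmonic_neumann {f : R3 → ℝ} {c B T : ℝ} (hcont : ContinuousOn f slab)
    (hB : ∀ p ∈ slab, f p ≤ B)
    (hT : ∀ p ∈ slab, T ≤ |p.2.2| → f p ≤ c)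
    (hsub : ∀ p : R3, p.1 ∈ Ioo (0 : ℝ) 1 → c < f p → ContDiffAt ℝ 2 f p ∧ 0 ≤ laplacian3 f p)
    (hbd : ∀ p : R3, p.1 = 0 ∨ p.1 = 1 → c < f p →
      HasDerivWithinAt (fun τ => f (τ, p.2.1, p.2.2)) 0 (Icc 0 1) p.1) :
    ∀ p ∈ slab, f p ≤ c := by
  intro p₀ hp₀
  by_contra! hlt
  -- rule out points where the barrier is too negative by cutting off at `|t| ≤ |T|`
  set D : ℝ := 3 * T ^ 2 with hD
  set b₀ : ℝ := p₀.2.1 ^ 2 + (p₀.1 - 1 / 2) ^ 2 - 3 * p₀.2.2 ^ 2 with hb₀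
  -- `-ε * D` bounds the barrier from below on `|t| ≤ T`. With this `ε`, the value `g p₀` still
  -- exceeds `c + ε * D`, and on `|t| ≤ T` that level forces `c < f`, where the hypotheses on `f`
  -- apply.
  obtain ⟨ε, hε, hε'⟩ : ∃ ε : ℝ, 0 < ε ∧ ε * (D + |b₀|) < f p₀ - c := by
    have hpos : 0 < D + |b₀| + 1 := by positivity
    refine ⟨(f p₀ - c) / (D + |b₀| + 1) , div_pos (by linarith) hpos, ?_⟩
    rw [div_mul_eq_mul_div, div_lt_iff₀ hpos]
    nlinarith
  set g : R3 → ℝ := fun q => f q - barrier ε q with hg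
  have hg₀ : c + ε * D < g p₀ := by
    have : barrier ε p₀ ≤ ε * |b₀| := by
      simp only [barrier]; exact mul_le_mul_of_nonneg_left (le_abs_self _) hε.le
    simp only [hg]; nlinarith
  have hkey : ∀ q ∈ slab, |q.2.2| ≤ T → c + ε * D < g q → c < f q := by
    intro q _ hqT hq
    have h2 : q.2.2 ^ 2 ≤ T ^ 2 := sq_le_sq' (by linarith [abs_le.1 hqT]) (abs_le.1 hqT).2
    have : -(ε * D) ≤ barrier ε q := by
      simp only [barrier, hD]
      nlinarith [mul_nonneg hε.le (sq_nonneg q.2.1), mul_nonneg hε.le (sq_nonneg (q.1 - 1 / 2)),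
        mul_le_mul_of_nonneg_left h2 hε.le]
    simp only [hg] at hq
    linarith
  have hT₀ : |p₀.2.2| < T := by
    by_contra! h
    linarith [hT p₀ hp₀ h]
  -- the maximum of `g` over the compact box
  obtain ⟨S, hS₀, hS⟩ : ∃ S : ℝ, |p₀.2.1| ≤ S ∧ B + ε * D < c + ε * D + ε * S ^ 2 := by
    -- Where `|s| ≥ S` and `|t| ≤ T` one has `g ≤ B + ε * D - ε * S ^ 2 < c + ε * D`, so the maximum
    -- over the box avoids those sides.
    refine ⟨|p₀.2.1| + (|B - c| / ε + 1), by
      have : 0 ≤ |B - c| / ε := by positivity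
      linarith, ?_⟩
    have h1 : |B - c| / ε + 1 ≤ (|p₀.2.1| + (|B - c| / ε + 1)) ^ 2 := by
      have : 0 ≤ |B - c| / ε := by positivity
      nlinarith [abs_nonneg p₀.2.1]
    have h2 : ε * (|B - c| / ε + 1) = |B - c| + ε := by field_simp
    nlinarith [mul_le_mul_of_nonneg_left h1 hε.le, le_abs_self (B - c)]
  set box : Set R3 := Icc (0 : ℝ) 1 ×ˢ (Icc (-S) S ×ˢ Icc (-T) T) with hbox
  have hbs : box ⊆ slab := prod_mono le_rfl (subset_univ _)
  obtain ⟨p, hp, hmax⟩ : ∃ p ∈ box, IsMaxOn g box p := by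
    refine IsCompact.exists_isMaxOn (isCompact_Icc.prod (isCompact_Icc.prod isCompact_Icc))
      ⟨p₀, hp₀.1, abs_le.1 hS₀, abs_le.1 hT₀.le⟩ ?_
    exact (hcont.mono hbs).sub (contDiff_barrier ε).continuous.continuousOn
  have hgp : c + ε * D < g p :=
    hg₀.trans_le (hmax ⟨hp₀.1, abs_le.1 hS₀, abs_le.1 hT₀.le⟩)
  have hpT : |p.2.2| ≤ T := abs_le.2 hp.2.2
  have hfp : c < f p := hkey p (hbs hp) hpT hgp
  have hpT' : |p.2.2| < T := by
    by_contra! h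
    linarith [hT p (hbs hp) h]
  have hpS' : |p.2.1| < S := by
    by_contra! h
    have h2 : S ^ 2 ≤ p.2.1 ^ 2 := by
      rw [← sq_abs p.2.1]
      exact pow_le_pow_left₀ ((abs_nonneg _).trans hS₀) h 2
    have h3 : p.2.2 ^ 2 ≤ T ^ 2 := sq_le_sq' (by linarith [abs_le.1 hpT]) (abs_le.1 hpT).2
    have : ε * S ^ 2 - ε * D ≤ barrier ε p := by
      simp only [barrier, hD]
      nlinarith [mul_le_mul_of_nonneg_left h2 hε.le, mul_nonneg hε.le (sq_nonneg (p.1 - 1 / 2)),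
        mul_le_mul_of_nonneg_left h3 hε.le]
    have h5 := hB p (hbs hp)
    simp only [hg] at hgp
    linarith
  have hbar : ∀ τ, HasDerivWithinAt (fun τ => barrier ε (τ, p.2.1, p.2.2))
      (ε * (2 * (τ - 1 / 2))) (Icc 0 1) τ := by
    intro τ
    have := (((((hasDerivAt_id τ).sub_const (1 / 2)).pow 2).const_add (p.2.1 ^ 2)).sub_const
      (3 * p.2.2 ^ 2)).const_mul ε
    simpa [barrier] using this.hasDerivWithinAt
  have hline : ∀ τ ∈ Icc (0 : ℝ) 1, g (τ, p.2.1, p.2.2) ≤ g p := fun τ hτ => hmax ⟨hτ, hp.2⟩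
  -- The Neumann condition leaves `∂_τ g = ε` at `τ = 0` and `-ε` at `τ = 1`; both have the wrong
  -- sign for a maximum on that face.
  rcases eq_or_lt_of_le hp.1.1 with h0 | h0
  · have hd := (hbd p (Or.inl h0.symm) hfp).sub (hbar p.1)
    rw [← h0] at hd
    have := le_zero_of_hasDerivWithinAt_of_max_left hd
      (fun τ hτ => by
        have := hline τ hτ
        rw [show p = (0, p.2.1, p.2.2) from Prod.ext h0.symm rfl] at this
        exact this)
    linarith
  rcases eq_or_lt_of_le hp.1.2 with h1 | h1
  · have hd := (hbd p (Or.inr h1) hfp).sub (hbar p.1)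
    rw [h1] at hd
    have := zero_le_of_hasDerivWithinAt_of_max_right hd
      (fun τ hτ => by
        have := hline τ hτ
        rw [show p = (1, p.2.1, p.2.2) from Prod.ext h1 rfl] at this
        exact this)
    linarith
  -- At an interior maximum `Δg ≤ 0`, whereas `Δg ≥ 2 * ε`.
  obtain ⟨hC2, hL⟩ := hsub p ⟨h0, h1⟩ hfp
  have hbC : ContDiffAt ℝ 2 (barrier ε) p := (contDiff_barrier ε).contDiffAt
  have hnhds : box ∈ 𝓝 p :=
    prod_mem_nhds (Icc_mem_nhds h0 h1) (prod_mem_nhds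
      (Icc_mem_nhds (abs_lt.1 hpS').1 (abs_lt.1 hpS').2)
      (Icc_mem_nhds (abs_lt.1 hpT').1 (abs_lt.1 hpT').2))
  have hloc : IsLocalMax g p := hmax.isLocalMax hnhds
  have hle : ∀ e, dirDeriv2 f e p - dirDeriv2 (barrier ε) e p ≤ 0 := fun e => by
    rw [← dirDeriv2_sub hC2 hbC]
    exact dirDeriv2_nonpos_of_isLocalMax (hC2.sub hbC) hloc e
  have hb := laplacian3_barrier ε p
  simp only [laplacian3] at hb hL
  linarith [hle eTau, hle eS, hle eT]

/-! ### Bounds from the asymptotics of Fueter strips -/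

section

variable {E : Type*} [NormedAddCommGroup E] [NormedSpace ℝ E]
variable {M : Type*} [TopologicalSpace M] [ChartedSpace E M] [IsManifold 𝓘(ℝ, E) ∞ M]

/-- Only base points matter, so the direction `0` suffices; the inequality for `ρ` cuts out an open
neighbourhood of the diagonal of `TM × TM`. -/
lemma ConvC1On.eventually_abs_sub_lt {S C : Set (ℝ × ℝ)} {ι : Type*} {F : ι → ℝ × ℝ → M}
    {l : Filter ι} {f : ℝ × ℝ → M} (h : ConvC1On (E := E) S C F l f) {ρ : M → ℝ}
    (hρ : Continuous ρ) {ε : ℝ} (hε : 0 < ε) :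
    ∀ᶠ i in l, ∀ z ∈ C, |ρ (f z) - ρ (F i z)| < ε := by
  have hπ : Continuous (TotalSpace.proj : TangentBundle 𝓘(ℝ, E) M → M) :=
    FiberBundle.continuous_proj E _
  refine h 0 {a | |ρ a.1.proj - ρ a.2.proj| < ε} ?_ (fun y => by simpa using hε)
  exact isOpen_lt (((hρ.comp (hπ.comp continuous_fst)).sub
    (hρ.comp (hπ.comp continuous_snd))).abs) continuous_const

/-- Convergence to `u_±` is uniform in `(t, τ)`, so a slice far out in `s` is compared through `u_±`
with the slice at `s = ±S`. This reduces questions about all `s` to a compact interval. -/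
lemma IsFueterStrip.exists_slice_bound {Q : QuatStructure E M} {L₀ L₁ : Set M} {U : R3 → M}
    (hU : IsFueterStrip Q L₀ L₁ U) {ρ : M → ℝ} (hρ : Continuous ρ) {ε : ℝ} (hε : 0 < ε) :
    ∃ S : ℝ, ∀ p ∈ slab, ∃ s ∈ Icc (-S) S, ρ (U p) ≤ ρ (U (p.1, s, p.2.2)) + ε := by
  obtain ⟨pm, -, pp, -, um, up, -, -, hm, hp, -⟩ := hU.asymptotics
  obtain ⟨a, ha⟩ := eventually_atBot.1 (hm.eventually_abs_sub_lt hρ (half_pos hε))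
  obtain ⟨b, hb⟩ := eventually_atTop.1 (hp.eventually_abs_sub_lt hρ (half_pos hε))
  refine ⟨|a| + |b|, fun p hps => ?_⟩
  have ha1 := neg_abs_le a
  have hb1 := le_abs_self b
  have ha2 := abs_nonneg a
  have hb2 := abs_nonneg b
  have hz : ((p.2.2, p.1) : ℝ × ℝ) ∈ stripTTau := ⟨trivial, hps.1⟩
  by_cases h1 : p.2.1 < -(|a| + |b|)
  · refine ⟨-(|a| + |b|), ⟨le_rfl, by linarith⟩, ?_⟩
    have e1 := abs_lt.1 (ha p.2.1 (by linarith) _ hz)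
    have e2 := abs_lt.1 (ha (-(|a| + |b|)) (by linarith) _ hz)
    simp only [Prod.mk.eta] at e1 e2
    linarith [e1.1, e1.2, e2.1, e2.2]
  by_cases h2 : |a| + |b| < p.2.1
  · refine ⟨|a| + |b|, ⟨by linarith, le_rfl⟩, ?_⟩
    have e1 := abs_lt.1 (hb p.2.1 (by linarith) _ hz)
    have e2 := abs_lt.1 (hb (|a| + |b|) (by linarith) _ hz)
    simp only [Prod.mk.eta] at e1 e2
    linarith [e1.1, e1.2, e2.1, e2.2]
  · exact ⟨p.2.1, ⟨not_lt.1 h1, not_lt.1 h2⟩, by simp only [Prod.mk.eta]; linarith⟩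

/-- Convergence as `t → ±∞` is uniform only for `s` in compact sets; the slice bound supplies the
other `s`. Each of the two errors costs half of `c - R`. -/
lemma IsFueterStrip.le_of_large_t {Q : QuatStructure E M} {L₀ L₁ : Set M} {U : R3 → M}
    (hU : IsFueterStrip Q L₀ L₁ U) {ρ : M → ℝ} (hρ : Continuous ρ) {R c : ℝ}
    (hR : ∀ x ∈ L₀ ∩ L₁, ρ x ≤ R) (hc : R < c) :
    ∃ T : ℝ, ∀ p ∈ slab, T ≤ |p.2.2| → ρ (U p) ≤ c := by
  have hε : 0 < (c - R) / 2 := by linarith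
  obtain ⟨S, hS⟩ := hU.exists_slice_bound hρ hε
  obtain ⟨pm, hpm, pp, hpp, um, up, -, -, -, -, ht⟩ := hU.asymptotics
  obtain ⟨hm, hp⟩ := ht (Icc (0 : ℝ) 1 ×ˢ Icc (-S) S) (prod_mono le_rfl (subset_univ _))
    (isCompact_Icc.prod isCompact_Icc)
  obtain ⟨a, ha⟩ := eventually_atBot.1 (hm.eventually_abs_sub_lt hρ hε)
  obtain ⟨b, hb⟩ := eventually_atTop.1 (hp.eventually_abs_sub_lt hρ hε)
  refine ⟨|a| + |b|, fun p hps hpt => ?_⟩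
  obtain ⟨s, hs, hle⟩ := hS p hps
  have ha1 := neg_abs_le a
  have hb1 := le_abs_self b
  have ha2 := abs_nonneg a
  have hb2 := abs_nonneg b
  rcases le_abs.1 hpt with h | h
  · have := (abs_lt.1 (hb p.2.2 (by linarith) (p.1, s) ⟨hps.1, hs⟩)).1
    have := hR pp hpp
    simp only at *
    linarith
  · have := (abs_lt.1 (ha p.2.2 (by linarith) (p.1, s) ⟨hps.1, hs⟩)).1
    have := hR pm hpm
    simp only at *
    linarith

lemma IsFueterStrip.continuousOn {Q : QuatStructure E M} {L₀ L₁ : Set M} {U : R3 → M}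
    (hU : IsFueterStrip Q L₀ L₁ U) {ρ : M → ℝ} (hρ : Continuous ρ) :
    ContinuousOn (fun p => ρ (U p)) slab :=
  hρ.comp_continuousOn hU.contMDiffOn.continuousOn

lemma IsFueterStrip.exists_bound {Q : QuatStructure E M} {L₀ L₁ : Set M} {U : R3 → M}
    (hU : IsFueterStrip Q L₀ L₁ U) {ρ : M → ℝ} (hρ : Continuous ρ) {R : ℝ}
    (hR : ∀ x ∈ L₀ ∩ L₁, ρ x ≤ R) : ∃ B : ℝ, ∀ p ∈ slab, ρ (U p) ≤ B := by
  obtain ⟨S, hS⟩ := hU.exists_slice_bound hρ one_pos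
  obtain ⟨T, hT⟩ := hU.le_of_large_t hρ hR (lt_add_one R)
  obtain ⟨B, hB⟩ := (isCompact_Icc.prod (isCompact_Icc.prod isCompact_Icc)).bddAbove_image
    ((hU.continuousOn hρ).mono (prod_mono le_rfl (subset_univ (Icc (-S) S ×ˢ Icc (-T) T))))
  refine ⟨max (R + 1) B + 1, fun p hp => ?_⟩
  obtain ⟨s, hs, hle⟩ := hS p hp
  refine hle.trans (add_le_add_left ?_ 1)
  by_cases h : T ≤ |p.2.2|
  · exact (hT (p.1, s, p.2.2) ⟨hp.1, trivial⟩ h).trans (le_max_left _ _)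
  · exact (hB ⟨(p.1, s, p.2.2), ⟨hp.1, hs, abs_le.1 (not_le.1 h).le⟩, rfl⟩).trans
      (le_max_right _ _)

end

/-! ### Levi forms and pull-backs -/

section

variable {E : Type*} [NormedAddCommGroup E] [NormedSpace ℝ E]
variable {M : Type*} [TopologicalSpace M] [ChartedSpace E M] [IsManifold 𝓘(ℝ, E) ∞ M]
variable {V : Type*} [NormedAddCommGroup V] [NormedSpace ℝ V]

lemma mdifferentiableAt_extChartAt_symm {x : M} {z : E} (hz : z ∈ (extChartAt 𝓘(ℝ, E) x).target) :
    MDifferentiableAt 𝓘(ℝ, E) 𝓘(ℝ, E) (extChartAt 𝓘(ℝ, E) x).symm z := by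
  have := mdifferentiableWithinAt_extChartAt_symm (I := 𝓘(ℝ, E)) hz
  rwa [modelWithCornersSelf_coe, range_id, mdifferentiableWithinAt_univ] at this

/-- In the chart at `x` the form is the derivative of `ρ ∘ φ⁻¹` composed with the coordinate matrix
of `A`, both smooth. The factors `dφ⁻¹ ∘ dφ` between them cancel. -/
lemma differentiableAt_oneFormInChart {A : ∀ x : M, TEnd E x} (hA : SmoothEnd A) {ρ : M → ℝ}
    (hρ : ContMDiff 𝓘(ℝ, E) 𝓘(ℝ, ℝ) ∞ ρ) (x : M) :
    DifferentiableAt ℝ (oneFormInChart (E := E) (fun y => (dFun ρ y).comp (A y)) x)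
      (extChartAt 𝓘(ℝ, E) x x) := by
  set φ := extChartAt 𝓘(ℝ, E) x with hφ
  have hA' := ((contMDiffAt_hom_bundle _).1 (hA x)).2
  have hA'' : ContMDiffAt 𝓘(ℝ, E) 𝓘(ℝ, E →L[ℝ] E) ∞ (fun z => ContinuousLinearMap.inCoordinates E
      (TangentSpace 𝓘(ℝ, E)) E (TangentSpace 𝓘(ℝ, E)) x (φ.symm z) x (φ.symm z) (A (φ.symm z)))
      (φ x) := by
    refine ContMDiffAt.comp_of_eq (y := x) (f := φ.symm) hA' ?_ (by simp [hφ])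
    exact (contMDiffOn_extChartAt_symm x).contMDiffAt (extChartAt_target_mem_nhds x)
  have hr : ContMDiffAt 𝓘(ℝ, E) 𝓘(ℝ, ℝ) ∞ (fun z => ρ (φ.symm z)) (φ x) :=
    hρ.contMDiffAt.comp _
      ((contMDiffOn_extChartAt_symm x).contMDiffAt (extChartAt_target_mem_nhds x))
  have hd : DifferentiableAt ℝ (fun z => (fderiv ℝ (fun z => ρ (φ.symm z)) z).comp
      (ContinuousLinearMap.inCoordinates E
      (TangentSpace 𝓘(ℝ, E)) E (TangentSpace 𝓘(ℝ, E)) x (φ.symm z) x (φ.symm z) (A (φ.symm z))))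
      (φ x) := by
    refine DifferentiableAt.clm_comp ?_ ?_
    · exact (hr.contDiffAt.fderiv_right (m := 1) (by norm_cast)).differentiableAt (by norm_num)
    · exact hA''.contDiffAt.differentiableAt (by simp)
  have heq : oneFormInChart (E := E) (fun y => (dFun ρ y).comp (A y)) x =ᶠ[𝓝 (φ x)] fun z =>
      ContinuousAlternatingMap.ofSubsingletonLIE (𝕜 := ℝ) (E := E) (F := ℝ) (0 : Fin 1)
      ((fderiv ℝ (fun z => ρ (φ.symm z)) z).comp
      (ContinuousLinearMap.inCoordinates E
      (TangentSpace 𝓘(ℝ, E)) E (TangentSpace 𝓘(ℝ, E)) x (φ.symm z) x (φ.symm z) (A (φ.symm z)))) := by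
    filter_upwards [extChartAt_target_mem_nhds (I := 𝓘(ℝ, E)) x] with z hz
    have hy : φ.symm z ∈ (chartAt E x).source := by
      rw [← extChartAt_source 𝓘(ℝ, E)]; exact φ.map_target hz
    have hsymm : MDifferentiableAt 𝓘(ℝ, E) 𝓘(ℝ, E) φ.symm z :=
      mdifferentiableAt_extChartAt_symm hz
    have hrz : fderiv ℝ (fun z => ρ (φ.symm z)) z = (dFun ρ (φ.symm z)).comp
        (mfderiv 𝓘(ℝ, E) 𝓘(ℝ, E) φ.symm z) := by
      rw [← mfderiv_eq_fderiv]
      exact mfderiv_comp z ((hρ _).mdifferentiableAt (by simp)) hsymm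
    have hφz : φ (φ.symm z) = z := φ.right_inv hz
    have hin : ContinuousLinearMap.inCoordinates E
        (TangentSpace 𝓘(ℝ, E)) E (TangentSpace 𝓘(ℝ, E)) x (φ.symm z) x (φ.symm z) (A (φ.symm z)) =
        (mfderiv 𝓘(ℝ, E) 𝓘(ℝ, E) φ (φ.symm z)).comp ((A (φ.symm z)).comp
          (mfderiv 𝓘(ℝ, E) 𝓘(ℝ, E) φ.symm z)) := by
      rw [ContinuousLinearMap.inCoordinates,
        TangentBundle.continuousLinearMapAt_trivializationAt hy,
        TangentBundle.symmL_trivializationAt hy]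
      rw [← hφ, hφz]
      simp only [modelWithCornersSelf_coe, range_id, mfderivWithin_univ]
      rfl
    have hid := mfderivWithin_extChartAt_symm_comp_mfderiv_extChartAt (I := 𝓘(ℝ, E)) hz
    rw [modelWithCornersSelf_coe, range_id, mfderivWithin_univ] at hid
    rw [hrz, hin]
    refine congrArg (ContinuousAlternatingMap.ofSubsingleton ℝ E ℝ (0 : Fin 1)) ?_
    ext v
    exact congrArg (dFun ρ (φ.symm z)) (DFunLike.congr_fun hid (A (φ.symm z)
      (mfderiv 𝓘(ℝ, E) 𝓘(ℝ, E) φ.symm z v))).symm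
  refine DifferentiableAt.congr_of_eventuallyEq ?_ heq
  exact (ContinuousAlternatingMap.ofSubsingletonLIE (𝕜 := ℝ) (E := E) (F := ℝ)
    (0 : Fin 1)).differentiable.differentiableAt.comp _ hd

/-- Expresses the derivatives at all nearby points through the single chart at `U p`, so that they
can be differentiated in `q`. -/
lemma mfderiv_eq_chart {U : V → M} {p : V} (hU : ContMDiffAt 𝓘(ℝ, V) 𝓘(ℝ, E) 2 U p) :
    ∀ᶠ q in 𝓝 p, mfderiv 𝓘(ℝ, V) 𝓘(ℝ, E) U q =
      (mfderiv 𝓘(ℝ, E) 𝓘(ℝ, E) (extChartAt 𝓘(ℝ, E) (U p)).symm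
        (extChartAt 𝓘(ℝ, E) (U p) (U q))).comp
        (fderiv ℝ (fun q => extChartAt 𝓘(ℝ, E) (U p) (U q)) q) := by
  set φ := extChartAt 𝓘(ℝ, E) (U p) with hφ
  have hev : ∀ᶠ q in 𝓝 p, ContMDiffAt 𝓘(ℝ, V) 𝓘(ℝ, E) 2 U q := 
    (contMDiffAt_iff_contMDiffAt_nhds (by simp)).1 hU
  have hsrc : ∀ᶠ q in 𝓝 p, U q ∈ φ.source :=
    hU.continuousAt.eventually (extChartAt_source_mem_nhds (I := 𝓘(ℝ, E)) (U p))
  filter_upwards [hev, hsrc.eventually_nhds] with q hq hs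
  have hqs : U q ∈ φ.source := hs.self_of_nhds
  have hUq : MDifferentiableAt 𝓘(ℝ, V) 𝓘(ℝ, E) U q := hq.mdifferentiableAt (by norm_num)
  have hφq : MDifferentiableAt 𝓘(ℝ, E) 𝓘(ℝ, E) φ (U q) :=
    mdifferentiableAt_extChartAt (by rwa [← extChartAt_source 𝓘(ℝ, E)])
  have hsymm : MDifferentiableAt 𝓘(ℝ, E) 𝓘(ℝ, E) φ.symm (φ (U q)) :=
    mdifferentiableAt_extChartAt_symm (φ.map_source hqs)
  have heq : U =ᶠ[𝓝 q] φ.symm ∘ (fun q => φ (U q)) := by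
    filter_upwards [hs] with r hr using (φ.left_inv hr).symm
  exact ((hsymm.hasMFDerivAt.comp q
    (hφq.comp q hUq).differentiableAt.hasFDerivAt.hasMFDerivAt).congr_of_eventuallyEq heq).mfderiv

/-- This is `U^* dθ = d(U^* θ)` for `θ = dρ ∘ A`, evaluated on constant vector fields, for which
there is no bracket term. -/
lemma oneForm_comp_mfderiv  {A : ∀ x : M, TEnd E x} (hA : SmoothEnd A) {ρ : M → ℝ}
    (hρ : ContMDiff 𝓘(ℝ, E) 𝓘(ℝ, ℝ) ∞ ρ) {U : V → M} {p : V}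
    (hU : ContMDiffAt 𝓘(ℝ, V) 𝓘(ℝ, E) 2 U p) (v w : V) :
    DifferentiableAt ℝ (fun q => dFun ρ (U q) (A (U q) (mfderiv 𝓘(ℝ, V) 𝓘(ℝ, E) U q v))) p ∧
    leviForm A ρ (U p) (mfderiv 𝓘(ℝ, V) 𝓘(ℝ, E) U p v) (mfderiv 𝓘(ℝ, V) 𝓘(ℝ, E) U p w) =
      fderiv ℝ (fun q => dFun ρ (U q) (A (U q) (mfderiv 𝓘(ℝ, V) 𝓘(ℝ, E) U q v))) p w -
      fderiv ℝ (fun q => dFun ρ (U q) (A (U q) (mfderiv 𝓘(ℝ, V) 𝓘(ℝ, E) U q w))) p v := by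
  set φ := extChartAt 𝓘(ℝ, E) (U p) with hφ
  set θ : ∀ y : M, TangentSpace 𝓘(ℝ, E) y →L[ℝ] ℝ := fun y => (dFun ρ y).comp (A y) with hθ
  set W : V → E := fun q => φ (U q) with hW
  have hWC : ContDiffAt ℝ 2 W p :=
    ((contMDiffAt_extChartAt (I := 𝓘(ℝ, E)) (n := 2) (x := U p)).comp p hU).contDiffAt
  have hω := differentiableAt_oneFormInChart hA hρ (U p)
  set Λ : V → V [⋀^Fin 1]→L[ℝ] ℝ := fun q =>
    (oneFormInChart θ (U p) (W q)).compContinuousLinearMap (fderiv ℝ W q) with hΛ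
  have hΛd : DifferentiableAt ℝ Λ p := by
    have h1 : DifferentiableAt ℝ (fun q =>
        ((ContinuousAlternatingMap.ofSubsingletonLIE (𝕜 := ℝ) (E := E) (F := ℝ) (0 : Fin 1)).symm
          (oneFormInChart θ (U p) (W q))).comp (fderiv ℝ W q)) p := by
      refine DifferentiableAt.clm_comp ?_
        ((hWC.fderiv_right (m := 1) (by norm_num)).differentiableAt (by norm_num))
      have hω' : DifferentiableAt ℝ (fun q => oneFormInChart θ (U p) (W q)) p :=
        DifferentiableAt.comp (f := W) p hω (hWC.differentiableAt (by norm_num))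
      exact (LinearIsometryEquiv.differentiable _).differentiableAt.comp p hω'
    exact (ContinuousAlternatingMap.ofSubsingletonLIE (𝕜 := ℝ) (E := V) (F := ℝ)
      (0 : Fin 1)).differentiable.differentiableAt.comp p h1
  have hΛeq : ∀ v : V, (fun q => θ (U q) (mfderiv 𝓘(ℝ, V) 𝓘(ℝ, E) U q v)) =ᶠ[𝓝 p]
      fun q => Λ q ![v] := by
    intro v
    have hsrc : ∀ᶠ q in 𝓝 p, U q ∈ φ.source :=
      hU.continuousAt.eventually (extChartAt_source_mem_nhds (I := 𝓘(ℝ, E)) (U p))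
    filter_upwards [mfderiv_eq_chart hU, hsrc] with q hq hs
    have hUq : φ.symm (W q) = U q := φ.left_inv hs
    have : Λ q ![v] = θ (φ.symm (W q))
        (mfderiv 𝓘(ℝ, E) 𝓘(ℝ, E) φ.symm (W q) (fderiv ℝ W q v)) := rfl
    rw [this, hq]
    -- All tangent spaces are definitionally `E`, so the base point can be changed with the vector
    -- kept fixed.
    have hbase : ∀ y, y = U q → ∀ e : E, (θ (U q) : E →L[ℝ] ℝ) e = (θ y : E →L[ℝ] ℝ) e := by
      rintro _ rfl _
      rfl
    exact hbase _ hUq _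
  have hext : extDeriv Λ p = (extDeriv (oneFormInChart θ (U p)) (W p)).compContinuousLinearMap
      (fderiv ℝ W p) := extDeriv_pullback hω hWC (by simp)
  have hφp : MDifferentiableAt 𝓘(ℝ, E) 𝓘(ℝ, E) φ (U p) :=
    mdifferentiableAt_extChartAt (mem_chart_source E (U p))
  have hchain : ∀ v : V, fderiv ℝ W p v = mfderiv 𝓘(ℝ, E) 𝓘(ℝ, E) φ (U p)
      (mfderiv 𝓘(ℝ, V) 𝓘(ℝ, E) U p v) := fun v => by
    have := mfderiv_comp p hφp (hU.mdifferentiableAt (by norm_num))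
    rw [mfderiv_eq_fderiv] at this
    exact DFunLike.congr_fun this v
  have hd : ∀ v : V, DifferentiableAt ℝ (fun q => Λ q ![v]) p := fun v => by
    fun_prop
  refine ⟨(hd v).congr_of_eventuallyEq (hΛeq v), ?_⟩
  have e1 : leviForm A ρ (U p) (mfderiv 𝓘(ℝ, V) 𝓘(ℝ, E) U p v) (mfderiv 𝓘(ℝ, V) 𝓘(ℝ, E) U p w)
      = - extDeriv Λ p ![v, w] := by
    rw [hext]
    have : (![mfderiv 𝓘(ℝ, E) 𝓘(ℝ, E) φ (U p) (mfderiv 𝓘(ℝ, V) 𝓘(ℝ, E) U p v),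
        mfderiv 𝓘(ℝ, E) 𝓘(ℝ, E) φ (U p) (mfderiv 𝓘(ℝ, V) 𝓘(ℝ, E) U p w)] : Fin 2 → E) =
        fderiv ℝ W p ∘ ![v, w] := by
      funext i
      fin_cases i
      · exact (hchain v).symm
      · exact (hchain w).symm
    exact congrArg (fun m => -extDeriv (oneFormInChart θ (U p)) (W p) m) this
  have e2 : ∀ v : V, fderiv ℝ (fun q => dFun ρ (U q) (A (U q) (mfderiv 𝓘(ℝ, V) 𝓘(ℝ, E) U q v))) p
      = fderiv ℝ (fun q => Λ q ![v]) p := fun v => (hΛeq v).fderiv_eq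
  rw [e1, e2, e2, extDeriv_apply hΛd]
  have r0 : Fin.removeNth 0 ![v, w] = ![w] := by ext i; fin_cases i; rfl
  have r1 : Fin.removeNth 1 ![v, w] = ![v] := by ext i; fin_cases i; rfl
  rw [Fin.sum_univ_two, r0, r1]
  simp [sub_eq_add_neg]

end

/-! ### Subharmonicity and boundary condition along Fueter maps -/

/-- The witnessing curve is the image of a full line; the faces of the slab contain such lines in
every direction with zero `τ`-component. -/
lemma isTangentTo_mfderivWithin {E : Type*} [NormedAddCommGroup E] [NormedSpace ℝ E]
    {M : Type*} [TopologicalSpace M] [ChartedSpace E M] {U : R3 → M} {S : Set R3}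
    (hU : ContMDiffOn 𝓘(ℝ, R3) 𝓘(ℝ, E) 2 U S) {L : Set M} {p e : R3}
    (hS : ∀ r : ℝ, p + r • e ∈ S) (hL : ∀ r : ℝ, U (p + r • e) ∈ L) :
    IsTangentTo L (U p) (mfderivWithin 𝓘(ℝ, R3) 𝓘(ℝ, E) U S p e) := by
  have hline : ContMDiff 𝓘(ℝ, ℝ) 𝓘(ℝ, R3) 1 fun r : ℝ => p + r • e := by
    apply ContDiff.contMDiff
    fun_prop
  refine ⟨fun r => U (p + r • e), (hU.of_le (by norm_num)).comp_contMDiff hline hS, hL, ?_⟩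
  have hp : p + (0 : ℝ) • e = p := by simp
  have hd : HasDerivAt (fun r : ℝ => p + r • e) e 0 := by
    simpa using ((hasDerivAt_id (0 : ℝ)).smul_const e).const_add p
  have hUd : MDifferentiableWithinAt 𝓘(ℝ, R3) 𝓘(ℝ, E) U S (p + (0 : ℝ) • e) :=
    (hU _ (hS 0)).mdifferentiableWithinAt (by norm_num)
  have hcomp := hUd.hasMFDerivWithinAt.comp (0 : ℝ)
    (hd.hasFDerivAt.hasMFDerivAt.hasMFDerivWithinAt (s := univ)) (fun r _ => hS r)
  rw [hasMFDerivWithinAt_univ] at hcomp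
  have h1 : mfderiv 𝓘(ℝ, ℝ) 𝓘(ℝ, E) (fun r : ℝ => U (p + r • e)) 0 (1 : ℝ) =
      mfderivWithin 𝓘(ℝ, R3) 𝓘(ℝ, E) U S (p + (0 : ℝ) • e) e := by
    refine (DFunLike.congr_fun hcomp.mfderiv (1 : ℝ)).trans ?_
    refine congrArg (mfderivWithin 𝓘(ℝ, R3) 𝓘(ℝ, E) U S (p + (0 : ℝ) • e)) ?_
    exact one_smul ℝ e
  have h2 := congrArg (fun y => (⟨U y, mfderivWithin 𝓘(ℝ, R3) 𝓘(ℝ, E) U S y e⟩ :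
    TangentBundle 𝓘(ℝ, E) M)) hp
  refine Eq.trans ?_ h2
  exact congrArg (fun w => (⟨U (p + (0 : ℝ) • e), w⟩ : TangentBundle 𝓘(ℝ, E) M)) h1

section

variable {E : Type*} [NormedAddCommGroup E] [NormedSpace ℝ E]
variable {M : Type*} [TopologicalSpace M] [ChartedSpace E M] [IsManifold 𝓘(ℝ, E) ∞ M]

/-! ### Quaternion relations, and the Fueter equation solved for each partial derivative -/

namespace QuatStructure

variable (Q : QuatStructure E M) (x : M) (v : TangentSpace 𝓘(ℝ, E) x)

/-- Anticommutation is not assumed: `K² = -1` applied to `J v` gives `I J I v = J v`, and applying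
`I` once more yields the claim. -/
lemma J_I : Q.J x (Q.I x v) = -Q.K x v := by
  have h := Q.K_sq x (Q.J x v)
  rw [← Q.I_J, ← Q.I_J, Q.J_sq, map_neg, map_neg, map_neg, neg_inj] at h
  have h2 := Q.I_sq x (Q.J x (Q.I x v))
  rw [h, Q.I_J] at h2
  rw [h2, neg_neg]

lemma J_K : Q.J x (Q.K x v) = Q.I x v := by
  rw [← Q.I_J, J_I, ← Q.I_J, Q.J_sq, map_neg, neg_neg]

lemma I_K : Q.I x (Q.K x v) = -Q.J x v := by
  rw [← Q.I_J, Q.I_sq]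

lemma K_I : Q.K x (Q.I x v) = Q.J x v := by
  rw [← Q.I_J, J_I, map_neg, I_K, neg_neg]

lemma K_J : Q.K x (Q.J x v) = -Q.I x v := by
  rw [← Q.I_J, Q.J_sq, map_neg]

end QuatStructure

lemma IsQuatAntilinear.eTau_eq {Q : QuatStructure E M} {x : M}
    {A : R3 →L[ℝ] TangentSpace 𝓘(ℝ, E) x} (h : IsQuatAntilinear Q x A) :
    Q.J x (A eT) - Q.K x (A eS) = -A eTau := by
  have := congrArg (Q.I x) h
  rw [map_add, map_add, Q.I_sq, Q.I_J, Q.I_K, map_zero] at this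
  rw [← sub_eq_zero, ← neg_eq_zero, ← this]
  abel

lemma IsQuatAntilinear.eS_eq {Q : QuatStructure E M} {x : M}
    {A : R3 →L[ℝ] TangentSpace 𝓘(ℝ, E) x} (h : IsQuatAntilinear Q x A) :
    Q.K x (A eTau) - Q.I x (A eT) = -A eS := by
  have := congrArg (Q.J x) h
  rw [map_add, map_add, Q.J_sq, Q.J_I, Q.J_K, map_zero] at this
  rw [← sub_eq_zero, ← neg_eq_zero, ← this]
  abel

lemma IsQuatAntilinear.eT_eq {Q : QuatStructure E M} {x : M}
    {A : R3 →L[ℝ] TangentSpace 𝓘(ℝ, E) x} (h : IsQuatAntilinear Q x A) :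
    Q.I x (A eS) - Q.J x (A eTau) = -A eT := by
  have := congrArg (Q.K x) h
  rw [map_add, map_add, Q.K_sq, Q.K_I, Q.K_J, map_zero] at this
  rw [← sub_eq_zero, ← neg_eq_zero, ← this]
  abel

/-- For a Fueter map `U`, the pull-back of the `IJK`-Levi form is minus the Laplacian of `ρ ∘ U`. -/
theorem leviPullback_mfderiv_eq_neg_laplacian {Q : QuatStructure E M} {ρ : M → ℝ}
    (hρ : ContMDiff 𝓘(ℝ, E) 𝓘(ℝ, ℝ) ∞ ρ) {U : R3 → M} {p : R3}
    (hU : ContMDiffAt 𝓘(ℝ, R3) 𝓘(ℝ, E) 2 U p)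
    (hF : ∀ᶠ q in 𝓝 p, IsQuatAntilinear Q (U q) (mfderiv 𝓘(ℝ, R3) 𝓘(ℝ, E) U q)) :
    leviPullback Q ρ (U p) (mfderiv 𝓘(ℝ, R3) 𝓘(ℝ, E) U p) = -laplacian3 (fun q => ρ (U q)) p := by
  have hI := oneForm_comp_mfderiv Q.smooth_I hρ hU
  have hJ := oneForm_comp_mfderiv Q.smooth_J hρ hU
  have hK := oneForm_comp_mfderiv Q.smooth_K hρ hU
  have hgrad : ∀ᶠ q in 𝓝 p, ∀ e : R3, fderiv ℝ (fun q => ρ (U q)) q e =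
      dFun ρ (U q) (mfderiv 𝓘(ℝ, R3) 𝓘(ℝ, E) U q e) := by
    filter_upwards [(contMDiffAt_iff_contMDiffAt_nhds (by simp)).1 hU] with q hq e
    have := mfderiv_comp q ((hρ (U q)).mdifferentiableAt (by simp))
      (hq.mdifferentiableAt (by norm_num))
    rw [mfderiv_eq_fderiv] at this
    exact DFunLike.congr_fun this e
  have hS : dirDeriv2 (fun q => ρ (U q)) eS p = -(fderiv ℝ
      (fun q => dFun ρ (U q) (Q.K (U q) (mfderiv 𝓘(ℝ, R3) 𝓘(ℝ, E) U q eTau))) p eS - fderiv ℝ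
      (fun q => dFun ρ (U q) (Q.I (U q) (mfderiv 𝓘(ℝ, R3) 𝓘(ℝ, E) U q eT))) p eS) := by
    have h : (fun q => fderiv ℝ (fun q => ρ (U q)) q eS) =ᶠ[𝓝 p] fun q =>
        -(dFun ρ (U q) (Q.K (U q) (mfderiv 𝓘(ℝ, R3) 𝓘(ℝ, E) U q eTau)) -
          dFun ρ (U q) (Q.I (U q) (mfderiv 𝓘(ℝ, R3) 𝓘(ℝ, E) U q eT))) := by
      filter_upwards [hF, hgrad] with q hq hg
      rw [hg, ← map_sub, ← map_neg]
      exact congrArg _ (neg_eq_iff_eq_neg.2 hq.eS_eq).symm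
    rw [dirDeriv2, h.fderiv_eq, fderiv_fun_neg, fderiv_fun_sub (hK eTau 0).1 (hI eT 0).1]
    rfl
  have hT : dirDeriv2 (fun q => ρ (U q)) eT p = -(fderiv ℝ
      (fun q => dFun ρ (U q) (Q.I (U q) (mfderiv 𝓘(ℝ, R3) 𝓘(ℝ, E) U q eS))) p eT - fderiv ℝ
      (fun q => dFun ρ (U q) (Q.J (U q) (mfderiv 𝓘(ℝ, R3) 𝓘(ℝ, E) U q eTau))) p eT) := by
    have h : (fun q => fderiv ℝ (fun q => ρ (U q)) q eT) =ᶠ[𝓝 p] fun q =>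
        -(dFun ρ (U q) (Q.I (U q) (mfderiv 𝓘(ℝ, R3) 𝓘(ℝ, E) U q eS)) -
          dFun ρ (U q) (Q.J (U q) (mfderiv 𝓘(ℝ, R3) 𝓘(ℝ, E) U q eTau))) := by
      filter_upwards [hF, hgrad] with q hq hg
      rw [hg, ← map_sub, ← map_neg]
      exact congrArg _ (neg_eq_iff_eq_neg.2 hq.eT_eq).symm
    rw [dirDeriv2, h.fderiv_eq, fderiv_fun_neg, fderiv_fun_sub (hI eS 0).1 (hJ eTau 0).1]
    rfl
  have hτ : dirDeriv2 (fun q => ρ (U q)) eTau p = -(fderiv ℝ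
      (fun q => dFun ρ (U q) (Q.J (U q) (mfderiv 𝓘(ℝ, R3) 𝓘(ℝ, E) U q eT))) p eTau - fderiv ℝ
      (fun q => dFun ρ (U q) (Q.K (U q) (mfderiv 𝓘(ℝ, R3) 𝓘(ℝ, E) U q eS))) p eTau) := by
    have h : (fun q => fderiv ℝ (fun q => ρ (U q)) q eTau) =ᶠ[𝓝 p] fun q =>
        -(dFun ρ (U q) (Q.J (U q) (mfderiv 𝓘(ℝ, R3) 𝓘(ℝ, E) U q eT)) -
          dFun ρ (U q) (Q.K (U q) (mfderiv 𝓘(ℝ, R3) 𝓘(ℝ, E) U q eS))) := by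
      filter_upwards [hF, hgrad] with q hq hg
      rw [hg, ← map_sub, ← map_neg]
      exact congrArg _ (neg_eq_iff_eq_neg.2 hq.eTau_eq).symm
    rw [dirDeriv2, h.fderiv_eq, fderiv_fun_neg, fderiv_fun_sub (hJ eT 0).1 (hK eS 0).1]
    rfl
  -- The six mixed terms regroup by `I`, `J`, `K` into the three pulled-back exterior derivatives.
  have e : leviPullback Q ρ (U p) (mfderiv 𝓘(ℝ, R3) 𝓘(ℝ, E) U p) = _ :=
    congrArg₂ (· + ·) (congrArg₂ (· + ·) (hI eS eT).2 (hJ eT eTau).2) (hK eTau eS).2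
  rw [e, laplacian3, hS, hT, hτ]
  ring

/-- Covers critical points of `U`, where the derivative is zero. Weak subharmonicity is enough, as
the barrier provides strictness. -/
lemma IsQuatConvexAt.leviPullback_nonpos {Q : QuatStructure E M} {ρ : M → ℝ} {x : M}
    (h : IsQuatConvexAt Q ρ x) {A : R3 →L[ℝ] TangentSpace 𝓘(ℝ, E) x}
    (hA : IsQuatAntilinear Q x A) : leviPullback Q ρ x A ≤ 0 := by
  by_cases h0 : A = 0
  · subst h0
    have hz : ∀ (B : ∀ x : M, TEnd E x), leviForm B ρ x 0 0 = 0 := fun B => by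
      simp only [leviForm, dOneForm, map_zero, neg_eq_zero]
      exact ContinuousAlternatingMap.map_coord_zero _ (0 : Fin 2) rfl
    exact (show leviPullback Q ρ x 0 = _ from
      congrArg₂ (· + ·) (congrArg₂ (· + ·) (hz Q.I) (hz Q.J)) (hz Q.K)).trans (by simp) |>.le
  · exact (h A hA h0).le

/-! ### The boundary condition -/

/-- `dρ` vanishes on `J(TL)` and `K(TL)` at the points of `L` where `ρ` is larger than `R`. -/
def ConicalAbove (Q : QuatStructure E M) (ρ : M → ℝ) (L : Set M) (R : ℝ) : Prop :=
  ∀ x ∈ L, R < ρ x → ∀ v : TangentSpace 𝓘(ℝ, E) x, IsTangentTo L x v →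
    dFun ρ x (Q.J x v) = 0 ∧ dFun ρ x (Q.K x v) = 0

lemma exists_le_of_isCompact {ρ : M → ℝ} (hρ : Continuous ρ) {C : Set M} (hC : IsCompact C) :
    ∃ R : ℝ, ∀ x ∈ C, ρ x ≤ R := by
  obtain ⟨R, hR⟩ := hC.bddAbove_image hρ.continuousOn
  exact ⟨R, fun x hx => hR ⟨x, hx, rfl⟩⟩

/-- Above the maximum of `ρ` on a compact `L` the condition is vacuous, so both kinds of boundary
condition take one form. -/
lemma exists_conicalAbove {Q : QuatStructure E M} {ρ : M → ℝ} (hρ : Continuous ρ) {L : Set M}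
    (hL : IsCompact L ∨ IsJKConical Q ρ L) : ∃ R : ℝ, ConicalAbove Q ρ L R := by
  rcases hL with hL | ⟨C, hC, h⟩
  · obtain ⟨R, hR⟩ := exists_le_of_isCompact hρ hL
    exact ⟨R, fun x hx hlt => absurd (hR x hx) (not_le.2 hlt)⟩
  · obtain ⟨R, hR⟩ := exists_le_of_isCompact hρ hC
    exact ⟨R, fun x hx hlt => (h x hx fun hxC => absurd (hR x hxC) (not_le.2 hlt)).2⟩

lemma ConicalAbove.mono {Q : QuatStructure E M} {ρ : M → ℝ} {L : Set M} {R R' : ℝ}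
    (h : ConicalAbove Q ρ L R) (hR : R ≤ R') : ConicalAbove Q ρ L R' :=
  fun x hx hlt => h x hx (hR.trans_lt hlt)

lemma neumann_of_conicalAbove {Q : QuatStructure E M} {ρ : M → ℝ}
    (hρ : ContMDiff 𝓘(ℝ, E) 𝓘(ℝ, ℝ) ∞ ρ) {L : Set M} {R : ℝ} (hL : ConicalAbove Q ρ L R)
    {U : R3 → M} (hU : ContMDiffOn 𝓘(ℝ, R3) 𝓘(ℝ, E) 2 U slab) (hF : IsFueterOn Q U slab)
    {p : R3} (hp : p ∈ slab) (hUL : ∀ s t : ℝ, U (p.1, s, t) ∈ L) (hR : R < ρ (U p)) :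
    HasDerivWithinAt (fun τ => ρ (U (τ, p.2.1, p.2.2))) 0 (Icc 0 1) p.1 := by
  have hS : ∀ e : R3, e.1 = 0 → IsTangentTo L (U p)
      (mfderivWithin 𝓘(ℝ, R3) 𝓘(ℝ, E) U slab p e) := fun e he => by
    refine isTangentTo_mfderivWithin hU (fun r => ⟨?_, trivial⟩) fun r => ?_
    · simpa [he] using hp.1
    · have : p + r • e = (p.1, (p + r • e).2.1, (p + r • e).2.2) := by
        ext <;> simp [he]
      rw [this]
      exact hUL _ _
  have h0 : dFun ρ (U p) (mfderivWithin 𝓘(ℝ, R3) 𝓘(ℝ, E) U slab p eTau) = 0 := by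
    have hτ := (hF p hp).eTau_eq
    have h1 := congrArg (dFun ρ (U p)) hτ
    have hUp : U p ∈ L := hUL p.2.1 p.2.2
    rw [map_sub, map_neg] at h1
    -- In `∂_τ U = K ∂_s U - J ∂_t U` both terms on the right are killed by `dρ`.
    have h2 := (hL _ hUp hR _ (hS eT rfl)).1
    have h3 := (hL _ hUp hR _ (hS eS rfl)).2
    have h4 : dFun ρ (U p) (Q.J (U p) (mfderivWithin 𝓘(ℝ, R3) 𝓘(ℝ, E) U slab p eT)) -
      dFun ρ (U p) (Q.K (U p) (mfderivWithin 𝓘(ℝ, R3) 𝓘(ℝ, E) U slab p eS)) =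
      -dFun ρ (U p) (mfderivWithin 𝓘(ℝ, R3) 𝓘(ℝ, E) U slab p eTau) := h1
    rw [h2, h3] at h4
    linarith
  have hd := ((hρ (U p)).mdifferentiableAt (by simp)).hasMFDerivAt.comp_hasMFDerivWithinAt p
    ((hU p hp).mdifferentiableWithinAt (by norm_num)).hasMFDerivWithinAt
  have hline : HasDerivWithinAt (fun τ : ℝ => ((τ, p.2.1, p.2.2) : R3)) eTau (Icc 0 1) p.1 :=
    ((hasDerivAt_id p.1).prodMk ((hasDerivAt_const p.1 p.2.1).prodMk
      (hasDerivAt_const p.1 p.2.2))).hasDerivWithinAt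
  have := hd.hasFDerivWithinAt.comp_hasDerivWithinAt (t := slab) p.1 hline
    (fun τ hτ => mk_mem_prod hτ trivial)
  exact this.congr_deriv h0

theorem IsFueterStrip.le_of_conical {Q : QuatStructure E M} {ρ : M → ℝ}
    (hρ : ContMDiff 𝓘(ℝ, E) 𝓘(ℝ, ℝ) ∞ ρ) {L₀ L₁ : Set M} {R : ℝ}
    (hconv : ∀ x, R < ρ x → IsQuatConvexAt Q ρ x)
    (h₀ : ConicalAbove Q ρ L₀ R) (h₁ : ConicalAbove Q ρ L₁ R) (hcap : ∀ x ∈ L₀ ∩ L₁, ρ x ≤ R)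
    {U : R3 → M} (hU : IsFueterStrip Q L₀ L₁ U) {p : R3} (hp : p ∈ slab) : ρ (U p) ≤ R := by
  -- The limits `p_±` satisfy only `ρ ≤ R`, so control at large `|t|` is available for each `c > R`
  -- but not for `R` itself.
  refine le_of_forall_gt_imp_ge_of_dense fun c hc => ?_
  obtain ⟨B, hB⟩ := hU.exists_bound hρ.continuous hcap
  obtain ⟨T, hT⟩ := hU.le_of_large_t hρ.continuous hcap hc
  refine le_of_subharmonic_neumann (hU.continuousOn hρ.continuous) hB hT ?_ ?_ p hp
  · intro q hq hcq
    have hnhds : ∀ᶠ y in 𝓝 q, slab ∈ 𝓝 y := by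
      refine eventually_eventually_nhds.2 ?_
      exact prod_mem_nhds (Icc_mem_nhds hq.1 hq.2) univ_mem
    have hUq : ContMDiffAt 𝓘(ℝ, R3) 𝓘(ℝ, E) 2 U q :=
      hU.contMDiffOn.contMDiffAt hnhds.self_of_nhds
    have hF : ∀ᶠ y in 𝓝 q, IsQuatAntilinear Q (U y) (mfderiv 𝓘(ℝ, R3) 𝓘(ℝ, E) U y) := by
      filter_upwards [hnhds] with y hy
      have := hU.fueter y (mem_of_mem_nhds hy)
      rwa [mfderivWithin_of_mem_nhds hy] at this
    refine ⟨(((hρ.of_le (by norm_cast)).contMDiffAt).comp q hUq).contDiffAt, ?_⟩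
    have h1 := leviPullback_mfderiv_eq_neg_laplacian hρ hUq hF
    have h2 := (hconv (U q) (hc.trans hcq)).leviPullback_nonpos hF.self_of_nhds
    linarith
  · rintro q (hq | hq) hcq
    · exact neumann_of_conicalAbove hρ h₀ hU.contMDiffOn hU.fueter
        ⟨by simp [hq], trivial⟩ (fun s t => by rw [hq]; exact hU.boundary_zero s t) (hc.trans hcq)
    · exact neumann_of_conicalAbove hρ h₁ hU.contMDiffOn hU.fueter
        ⟨by simp [hq], trivial⟩ (fun s t => by rw [hq]; exact hU.boundary_one s t) (hc.trans hcq)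

end

end Fueter

theorem mainTheorem4 (n : ℕ) (M : Type*) [TopologicalSpace M] [T2Space M]
    [SecondCountableTopology M] [ChartedSpace (EuclideanSpace ℝ (Fin (4 * n))) M]
    [IsManifold 𝓘(ℝ, EuclideanSpace ℝ (Fin (4 * n))) ∞ M]
    (Q : Fueter.QuatStructure (EuclideanSpace ℝ (Fin (4 * n))) M)
    (ρ : M → ℝ) (hρ : Fueter.IsConicalEnd Q ρ)
    (L₀ L₁ : Set M)
    (hL₀ : Fueter.IsSubmanifold (EuclideanSpace ℝ (Fin (4 * n))) L₀)
    (hL₁ : Fueter.IsSubmanifold (EuclideanSpace ℝ (Fin (4 * n))) L₁)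
    (h₀ : IsCompact L₀ ∨ Fueter.IsJKConical Q ρ L₀)
    (h₁ : IsCompact L₁ ∨ Fueter.IsJKConical Q ρ L₁)
    (hcap : IsCompact (L₀ ∩ L₁)) :
    ∃ M₀ : Set M, IsCompact M₀ ∧
      ∀ U : Fueter.R3 → M, Fueter.IsFueterStrip Q L₀ L₁ U → U '' Fueter.slab ⊆ M₀ := by
  have hc := hρ.smooth.continuous
  obtain ⟨C, hC, hCρ⟩ := hρ.conical
  obtain ⟨R₀, hR₀⟩ := Fueter.exists_conicalAbove hc h₀
  obtain ⟨R₁, hR₁⟩ := Fueter.exists_conicalAbove hc h₁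
  obtain ⟨R₂, hR₂⟩ := Fueter.exists_le_of_isCompact hc hcap
  obtain ⟨R₃, hR₃⟩ := Fueter.exists_le_of_isCompact hc hC
  -- `R` is fixed before any strip is chosen, so one sublevel set serves for all of them.
  set R := max (max R₀ R₁) (max R₂ R₃)
  have l₀ : R₀ ≤ R := (le_max_left _ _).trans (le_max_left _ _)
  have l₁ : R₁ ≤ R := (le_max_right _ _).trans (le_max_left _ _)
  have l₂ : R₂ ≤ R := (le_max_left _ _).trans (le_max_right _ _)
  have l₃ : R₃ ≤ R := (le_max_right _ _).trans (le_max_right _ _)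
  refine ⟨{x | ρ x ≤ R}, hρ.exhausting R, ?_⟩
  rintro U hU _ ⟨p, hp, rfl⟩
  exact hU.le_of_conical hρ.smooth
    (fun x hx => (hCρ x fun hxC => absurd ((hR₃ x hxC).trans l₃) (not_le.2 hx)).1)
    (hR₀.mono l₀) (hR₁.mono l₁) (fun x hx => (hR₂ x hx).trans l₂) hp
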